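/- Let $\mathbb{TP}^n=\mathbb{R}^{n+1}/\mathbb{R}(1,\dots,1)$, let $r=(r_1,\dots,r_{n+1})\in\mathbb{R}^{n+1}$ have entries that are not all equal, let $L\subset\mathbb{TP}^n$ be the (ordinary) line generated by $r$, and let $k\ge 0$. The $k$-th tropical secant variety $S^k(L)$ is the set of classes of vectors $y^0\oplus\cdots\oplus y^k$ (coordinatewise minimum) where each $y^j\in\mathbb{R}^{n+1}$ represents a point of $L$. Every $x\in\mathbb{R}^{n+1}$ induces a regular subdivision $\Delta_x$ of the labelled point configuration $r_1,\dots,r_{n+1}$ on the real line: its cells are the sets $\{i : x_i=f(r_i)\}$, where $f$ is an affine function on $\mathbb{R}$ with $x_i\le f(r_i)$ for all $i$. The faces of the $k$-th tropical secant complex of $L$ are the regular subdivisions $\Delta_x$ induced by the points $[x]\in S^k(L)$ (equivalently, those having $k+1$ facets, i.e. maximal cells, repetitions allowed, which together contain all labels); a face $\Delta'$ contains a face $\Delta$ if and only if $\Delta'$ refines $\Delta$ (every cell of $\Delta'$ lies in a cell of $\Delta$), and the trivial subdivision is the empty face. Let $d$ be the number of distinct elements of $\{r_1,\dots,r_{n+1}\}$.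 Then the $k$-th tropical secant complex of $L$ is combinatorially isomorphic to the complex of lower faces of the cyclic polytope $C(2k,d-2)$ with $d-2$ points in dimension $2k$: for all real $t_1<\dots<t_{d-2}$, if $P$ is the convex hull of the points $(t_j,t_j^2,\dots,t_j^{2k})\in\mathbb{R}^{2k}$, there is a bijection between the faces of the secant complex and the lower faces of $P$ that preserves and reflects containment of faces. Here the lower faces of $P$ are the empty face and the sets of all minimizers over $P$ of a linear functional on $\mathbb{R}^{2k}$ whose last coordinate is positive (so that for $k=0$ only the empty face is a lower face, and for $d=2$, where $P=\emptyset$, likewise). -/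

import Mathlib

namespace TropicalSecant

/-- The tropical projective space `ℝ^ι / ℝ(1,…,1)`; for `ι = Fin (n + 1)` this is `𝕋ℙⁿ`. -/
abbrev TP (ι : Type*) : Type _ := (ι → ℝ) ⧸ Submodule.span ℝ {(1 : ι → ℝ)}

/-- The class in tropical projective space of a vector. -/
abbrev TP.mk {ι : Type*} (x : ι → ℝ) : TP ι := (Submodule.span ℝ {(1 : ι → ℝ)}).mkQ x

/-- The ordinary linear subspace of tropical projective space generated by the single vector `r`
(a line as soon as `r` is not constant). -/
def lineTP {ι : Type*} (r : ι → ℝ) : Submodule ℝ (TP ι) := Submodule.span ℝ {TP.mk r}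

/-- The tropical sum `y₀ ⊕ ⋯ ⊕ y_k`, i.e. the coordinatewise minimum. -/
def tropSum {ι : Type*} {k : ℕ} (y : Fin (k + 1) → ι → ℝ) : ι → ℝ :=
  fun i => Finset.univ.inf' Finset.univ_nonempty (fun j => y j i)

/-- The `k`-th tropical secant variety of `L`: all tropical sums of `k + 1` points of `L`
(each point of `L` may be represented by any of its representatives). -/
def secantVariety {ι : Type*} (L : Submodule ℝ (TP ι)) (k : ℕ) : Set (TP ι) :=
  {p | ∃ y : Fin (k + 1) → ι → ℝ, (∀ j, TP.mk (y j) ∈ L) ∧ p = TP.mk (tropSum y)}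

/-- The regular subdivision of the labelled point configuration `v` induced by the upper envelope
of the height vector `x`, as the collection of its cells. A cell is the set of labels of those
lifted points `(v i, x i)` that lie on the graph of an affine functional which is
nowhere below the lifted points. (The empty cell is included.) -/
def regularSubdivision {ι E : Type*} [AddCommGroup E] [Module ℝ E] (v : ι → E) (x : ι → ℝ) :
    Set (Set ι) :=
  {F | ∃ f : E →ᵃ[ℝ] ℝ, (∀ i, x i ≤ f (v i)) ∧ F = {i | x i = f (v i)}}

/-- The facets of a subdivision are its inclusion-maximal cells. -/
def IsFacet {ι : Type*} (S : Set (Set ι)) (F : Set ι) : Prop := Maximal (· ∈ S) F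

/-- `S` refines `T`: every cell of `S` is contained in a cell of `T`. -/
def Refines {ι : Type*} (S T : Set (Set ι)) : Prop := ∀ F ∈ S, ∃ G ∈ T, F ⊆ G

/-- The faces of the `k`-th tropical secant complex of the line generated by `r`: the regular
subdivisions of the point configuration `r i` on the real line that are induced by the points
of the `k`-th tropical secant variety. The subdivision `S` stands for the closed polyhedral cone
of all points whose subdivision is refined by `S`, so a face `T` contains a face `S` exactly when
`T` refines `S`; the trivial subdivision stands for the empty face.
See `mem_secantComplex_iff` for the description by facets. -/
def secantComplex {ι : Type*} (r : ι → ℝ) (k : ℕ) : Set (Set (Set ι)) :=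
  {S | ∃ x : ι → ℝ, TP.mk x ∈ secantVariety (lineTP r) k ∧ S = regularSubdivision r x}

/-- The point `(s, s², …, s^D)` of the moment curve. -/
def momentCurve (D : ℕ) (s : ℝ) : Fin D → ℝ := fun i => s ^ (i.val + 1)

/-- The cyclic polytope in dimension `D` on the points of the moment curve with parameters `t`. -/
def cyclicPolytope (D : ℕ) {N : ℕ} (t : Fin N → ℝ) : Set (Fin D → ℝ) :=
  convexHull ℝ (Set.range fun j => momentCurve D (t j))

/-- The lower faces of `P ⊆ ℝ^D`: the empty face, and the sets of minimizers over `P`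
of the linear functionals `c` whose last coordinate is positive. -/
def lowerFaces {D : ℕ} (P : Set (Fin D → ℝ)) : Set (Set (Fin D → ℝ)) :=
  {F | F = ∅ ∨ ∃ c : Fin D → ℝ, (∃ i : Fin D, i.val + 1 = D ∧ 0 < c i) ∧
    F = {p | p ∈ P ∧ ∀ q ∈ P, c ⬝ᵥ p ≤ c ⬝ᵥ q}}

lemma mk_eq_mk_iff {ι : Type*} (x y : ι → ℝ) :
    TP.mk x = TP.mk y ↔ ∃ a : ℝ, ∀ i, x i = y i + a := by
  rw [TP.mk, TP.mk, Submodule.mkQ_apply, Submodule.mkQ_apply, Submodule.Quotient.eq,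
    Submodule.mem_span_singleton]
  constructor
  · rintro ⟨a, ha⟩
    refine ⟨a, fun i => ?_⟩
    have := congrFun ha i
    simp at this
    linarith
  · rintro ⟨a, ha⟩
    refine ⟨a, funext fun i => ?_⟩
    simp [ha i]

lemma mk_mem_lineTP_iff {ι : Type*} (r y : ι → ℝ) :
    TP.mk y ∈ lineTP r ↔ ∃ f : ℝ →ᵃ[ℝ] ℝ, ∀ i, y i = f (r i) := by
  rw [lineTP, Submodule.mem_span_singleton]
  constructor
  · rintro ⟨c, hc⟩
    rw [← map_smul, eq_comm, mk_eq_mk_iff] at hc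
    obtain ⟨a, ha⟩ := hc
    refine ⟨(c • LinearMap.id : ℝ →ₗ[ℝ] ℝ).toAffineMap + AffineMap.const ℝ ℝ a, fun i => ?_⟩
    simp [ha i]
  · rintro ⟨f, hf⟩
    refine ⟨f.linear 1, ?_⟩
    rw [← map_smul, eq_comm, mk_eq_mk_iff]
    refine ⟨f 0, fun i => ?_⟩
    have h1 := congrFun (AffineMap.decomp f) (r i)
    have h2 : f.linear (r i) = r i * f.linear 1 := by
      have := f.linear.map_smul (r i) 1
      simpa using this
    simp only [Pi.add_apply, h2] at h1
    rw [hf i, h1]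
    simp [h2]

lemma mk_mem_secantVariety_iff {ι : Type*} (r x : ι → ℝ) (k : ℕ) :
    TP.mk x ∈ secantVariety (lineTP r) k ↔
      ∃ f : Fin (k + 1) → ℝ →ᵃ[ℝ] ℝ,
        (∀ j i, x i ≤ f j (r i)) ∧ ∀ i, ∃ j, x i = f j (r i) := by
  constructor
  · rintro ⟨y, hy, hxy⟩
    choose f hf using fun j => (mk_mem_lineTP_iff r (y j)).1 (hy j)
    obtain ⟨a, ha⟩ := (mk_eq_mk_iff _ _).1 hxy
    refine ⟨fun j => f j + AffineMap.const ℝ ℝ a, fun j i => ?_, fun i => ?_⟩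
    · have : tropSum y i ≤ y j i := Finset.inf'_le (fun j => y j i) (Finset.mem_univ j)
      simp [ha i, ← hf j i, this]
    · obtain ⟨j, -, hj⟩ := Finset.exists_mem_eq_inf' Finset.univ_nonempty (fun j => y j i)
      refine ⟨j, ?_⟩
      have : tropSum y i = y j i := hj
      simp [ha i, ← hf j i, this]
  · rintro ⟨f, h1, h2⟩
    refine ⟨fun j i => f j (r i), fun j => (mk_mem_lineTP_iff _ _).2 ⟨f j, fun _ => rfl⟩, ?_⟩
    congr 1
    funext i
    refine le_antisymm (Finset.le_inf' _ _ fun j _ => h1 j i) ?_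
    obtain ⟨j, hj⟩ := h2 i
    rw [hj]
    exact Finset.inf'_le (fun j => f j (r i)) (Finset.mem_univ j)

/-- The faces of the `k`-th secant complex are the regular subdivisions with `k + 1` facets
(repetitions allowed) whose union contains all of the points. -/
theorem mem_secantComplex_iff {ι : Type*} [Finite ι] (r : ι → ℝ) (k : ℕ) (S : Set (Set ι)) :
    S ∈ secantComplex r k ↔ (∃ x : ι → ℝ, S = regularSubdivision r x) ∧
      ∃ F : Fin (k + 1) → Set ι, (∀ j, IsFacet S (F j)) ∧ ⋃ j, F j = Set.univ := by
  constructor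
  · rintro ⟨x, hx, rfl⟩
    refine ⟨⟨x, rfl⟩, ?_⟩
    obtain ⟨f, h1, h2⟩ := (mk_mem_secantVariety_iff r x k).1 hx
    have key : ∀ j, ∃ G, {i | x i = f j (r i)} ⊆ G ∧ IsFacet (regularSubdivision r x) G :=
      fun j => (Set.toFinite (regularSubdivision r x)).exists_le_maximal ⟨f j, h1 j, rfl⟩
    choose G hG1 hG2 using key
    refine ⟨G, hG2, Set.eq_univ_of_forall fun i => ?_⟩
    obtain ⟨j, hj⟩ := h2 i
    exact Set.mem_iUnion.2 ⟨j, hG1 j hj⟩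
  · rintro ⟨⟨x, rfl⟩, F, hF, hU⟩
    choose f h1 h2 using fun j => (hF j).1
    refine ⟨x, (mk_mem_secantVariety_iff r x k).2 ⟨f, h1, fun i => ?_⟩, rfl⟩
    obtain ⟨j, hj⟩ := Set.mem_iUnion.1 (hU.symm ▸ Set.mem_univ i : i ∈ ⋃ j, F j)
    exact ⟨j, by rw [h2 j] at hj; exact hj⟩

end TropicalSecant

namespace TropicalSecant

/-! Both complexes are isomorphic to one poset: the sets `B` of labels in `{0, …, N - 1}`, `N = d -
2`, that `k` pairs of consecutive labels cover, ordered by inclusion.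

Tropical side (`secantComplex_eq_image`): let `s 0 < ⋯ < s (N + 1)` be the distinct values of `r`. A
point of the secant variety is a minimum of `k + 1` affine functions, hence concave in these values.
Modulo affine functions it is given by its slope drops `w j ≥ 0` at the inner values `s (j + 1)`,
and its subdivision depends only on the set of breaks `{j | w j ≠ 0}`; more breaks mean a finer
subdivision. The `k + 1` affine functions together touch it at every value, and none touches it on
both sides of a break. So breaks occur only at the `k` transitions from one function to the next,
each at the last value of the old one or at the value after it: `k` pairs of labels.

Polytope side (`lowerFaces_momentHull`): on the moment curve, a functional with positive last
coordinate is, up to a constant, a polynomial of degree `2 * k` with positive leading coefficient.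
The labels of a face are its zeros once it is normalized to have minimum zero on the `t j`. As in
Gale's evenness criterion, such zeros are covered by `k` pairs, and every set so covered is the zero
set of a product of `k` quadratics. -/

/-- `B` can be covered by `k` pairs of consecutive numbers. -/
def PairCover (k : ℕ) (B : Set ℕ) : Prop :=
  ∃ g : Fin k → ℕ, ∀ b ∈ B, ∃ j, b = g j ∨ b = g j + 1

/-- A finite strictly increasing sequence extends to an infinite one. -/
lemma exists_strictMono_extension {n : ℕ} (u : Fin n → ℝ) (hu : StrictMono u) :
    ∃ v : ℕ → ℝ, StrictMono v ∧ ∀ i : Fin n, v i = u i := by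
  classical
  obtain ⟨M, hM⟩ := (Set.finite_range u).bddAbove
  refine ⟨fun i => if h : i < n then u ⟨i, h⟩ else M + 1 + i, ?_, fun i => by simp⟩
  refine strictMono_nat_of_lt_succ fun i => ?_
  by_cases h1 : i + 1 < n
  · have h0 : i < n := by omega
    simp only [h0, h1, dif_pos]
    exact hu (by simp [Fin.lt_def])
  · by_cases h0 : i < n
    · simp only [h0, h1, dif_pos, dif_neg, not_false_eq_true]
      have := hM ⟨⟨i, h0⟩, rfl⟩
      have : (0 : ℝ) ≤ ((i + 1 : ℕ) : ℝ) := by positivity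
      linarith
    · simp only [h0, h1, dif_neg, not_false_eq_true]
      push_cast
      linarith

/-- The affine function `u ↦ a * u + b`. -/
def affineLine (a b : ℝ) : ℝ →ᵃ[ℝ] ℝ :=
  (a • LinearMap.id : ℝ →ₗ[ℝ] ℝ).toAffineMap + AffineMap.const ℝ ℝ b

@[simp] lemma affineLine_apply (a b u : ℝ) : affineLine a b u = a * u + b := by
  simp [affineLine]

lemma exists_eq_affineLine (f : ℝ →ᵃ[ℝ] ℝ) : ∃ a b, f = affineLine a b := by
  refine ⟨f.linear 1, f 0, AffineMap.ext fun u => ?_⟩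
  have h1 := congrFun (AffineMap.decomp f) u
  have h2 : f.linear u = u * f.linear 1 := by simpa using f.linear.map_smul u 1
  simp only [Pi.add_apply, h2] at h1
  rw [h1, affineLine_apply]
  simp [mul_comm]

/-! ### Concave piecewise linear functions and their breaks -/

/-- The convex piecewise linear function whose slope increases by `w j` at `s (j + 1)`. -/
noncomputable def hinge (s : ℕ → ℝ) (N : ℕ) (w : ℕ → ℝ) (u : ℝ) : ℝ :=
  ∑ j ∈ Finset.range N, w j * max 0 (u - s (j + 1))

/-- The linear piece of `-hinge s N w` between `s m` and `s (m + 1)`. -/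
noncomputable def hingePiece (s : ℕ → ℝ) (N : ℕ) (w : ℕ → ℝ) (m : ℕ) : ℝ →ᵃ[ℝ] ℝ :=
  affineLine (-∑ j ∈ Finset.range N, if j < m then w j else 0)
    (∑ j ∈ Finset.range N, if j < m then w j * s (j + 1) else 0)

section Hinge

variable {s : ℕ → ℝ} {N : ℕ} {w w' : ℕ → ℝ}

lemma hingePiece_apply (s : ℕ → ℝ) (N : ℕ) (w : ℕ → ℝ) (m : ℕ) (u : ℝ) :
    hingePiece s N w m u =
      -∑ j ∈ Finset.range N, if j < m then w j * (u - s (j + 1)) else 0 := by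
  rw [hingePiece, affineLine_apply, neg_mul, Finset.sum_mul, ← sub_eq_neg_add, ← neg_sub,
    ← Finset.sum_sub_distrib]
  congr 1
  refine Finset.sum_congr rfl fun j _ => ?_
  split_ifs <;> ring

lemma neg_hinge_le_hingePiece (hw : ∀ j, 0 ≤ w j) (m : ℕ) (u : ℝ) :
    -hinge s N w u ≤ hingePiece s N w m u := by
  rw [hingePiece_apply, hinge]
  refine neg_le_neg (Finset.sum_le_sum fun j _ => ?_)
  split_ifs
  · exact mul_le_mul_of_nonneg_left (le_max_right _ _) (hw j)
  · exact mul_nonneg (hw j) (le_max_left _ _)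

lemma neg_hinge_eq_hingePiece {m : ℕ} {u : ℝ}
    (h : ∀ j, w j ≠ 0 → (j < m → s (j + 1) ≤ u) ∧ (m ≤ j → u ≤ s (j + 1))) :
    -hinge s N w u = hingePiece s N w m u := by
  rw [hingePiece_apply, hinge]
  congr 1
  refine Finset.sum_congr rfl fun j _ => ?_
  by_cases hj : w j = 0
  · simp [hj]
  · obtain ⟨h1, h2⟩ := h j hj
    split_ifs with hm
    · rw [max_eq_right (sub_nonneg.2 (h1 hm))]
    · rw [max_eq_left (sub_nonpos.2 (h2 (not_lt.1 hm))), mul_zero]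

/-- An affine function above `-hinge s N w` does not touch it on both sides of a break. -/
lemma not_touch_both_sides (hw : ∀ j, 0 ≤ w j) {j : ℕ} (hj : j < N) (hwj : w j ≠ 0)
    {f : ℝ →ᵃ[ℝ] ℝ} {p q : ℝ} (hp : p < s (j + 1)) (hq : s (j + 1) < q)
    (hf : -hinge s N w (s (j + 1)) ≤ f (s (j + 1)))
    (hfp : -hinge s N w p = f p) (hfq : -hinge s N w q = f q) : False := by
  obtain ⟨a, b, rfl⟩ := exists_eq_affineLine f
  simp only [affineLine_apply] at hf hfp hfq
  set c := s (j + 1) with hc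
  -- Convexity of `hinge` at `c` between `p` and `q`. It is strict because summand `j` vanishes at
  -- `p` and at its own break `c` but is positive at `q`.
  have key : (q - p) * hinge s N w c < (q - c) * hinge s N w p + (c - p) * hinge s N w q := by
    simp only [hinge, Finset.mul_sum, ← Finset.sum_add_distrib]
    refine Finset.sum_lt_sum (fun i _ => ?_) ⟨j, Finset.mem_range.2 hj, ?_⟩
    · have h1 : (q - p) * max 0 (c - s (i + 1)) ≤
          (q - c) * max 0 (p - s (i + 1)) + (c - p) * max 0 (q - s (i + 1)) := by
        rcases max_cases 0 (c - s (i + 1)) with ⟨h, -⟩ | ⟨h, -⟩ <;> rw [h]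
        · rw [mul_zero]
          exact add_nonneg (mul_nonneg (by linarith) (le_max_left _ _))
            (mul_nonneg (by linarith) (le_max_left _ _))
        · have h2 := mul_le_mul_of_nonneg_left (le_max_right 0 (p - s (i + 1)))
            (show 0 ≤ q - c by linarith)
          have h3 := mul_le_mul_of_nonneg_left (le_max_right 0 (q - s (i + 1)))
            (show 0 ≤ c - p by linarith)
          linarith
      have := mul_le_mul_of_nonneg_left h1 (hw i)
      linarith
    · have hpos : 0 < w j := lt_of_le_of_ne (hw j) (Ne.symm hwj)
      rw [← hc, sub_self, max_self, mul_zero, mul_zero, max_eq_left (by linarith),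
        max_eq_right (by linarith), mul_zero, mul_zero, zero_add]
      exact mul_pos (by linarith) (mul_pos hpos (by linarith))
  have e1 : hinge s N w p = -(a * p + b) := by linarith
  have e2 : hinge s N w q = -(a * q + b) := by linarith
  have e3 := mul_le_mul_of_nonneg_left hf (show 0 ≤ q - p by linarith)
  rw [e1, e2] at key
  linarith

/-- A concave function on `s 0 < ⋯ < s (N + 1)` is an affine function minus a `hinge`. -/
lemma exists_eq_sub_hinge (hs : StrictMono s) (X : ℕ → ℝ)
    (hX : ∀ m ≤ N + 1, ∃ f : ℝ →ᵃ[ℝ] ℝ, X m = f (s m) ∧ ∀ i ≤ N + 1, X i ≤ f (s i)) :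
    ∃ (f : ℝ →ᵃ[ℝ] ℝ) (w : ℕ → ℝ), (∀ j, 0 ≤ w j) ∧ (∀ j, w j ≠ 0 → j < N) ∧
      ∀ i ≤ N + 1, X i = f (s i) - hinge s N w (s i) := by
  set σ : ℕ → ℝ := fun i => (X (i + 1) - X i) / (s (i + 1) - s i) with hσ
  have hd : ∀ i, 0 < s (i + 1) - s i := fun i => sub_pos.2 (hs (Nat.lt_succ_self i))
  have hanti : ∀ i < N, σ (i + 1) ≤ σ i := by
    intro i hi
    obtain ⟨f, h1, h2⟩ := hX (i + 1) (by omega)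
    obtain ⟨a, b, rfl⟩ := exists_eq_affineLine f
    have h3 := h2 i (by omega)
    have h4 := h2 (i + 1 + 1) (by omega)
    simp only [affineLine_apply] at h1 h3 h4
    -- The slope of an affine function supporting `X` at `s (i + 1)` separates the two adjacent
    -- chord slopes.
    refine le_trans (b := a) ?_ ?_
    · rw [hσ]; dsimp only
      rw [div_le_iff₀ (hd _)]
      linarith
    · rw [hσ]; dsimp only
      rw [le_div_iff₀ (hd _)]
      linarith
  -- The line through the first two points, with the drop of chord slope at `s (j + 1)` as weight.
  refine ⟨affineLine (σ 0) (X 0 - σ 0 * s 0), fun j => if j < N then σ j - σ (j + 1) else 0,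
    fun j => ?_, fun j => ?_, fun i => ?_⟩
  · dsimp only
    split_ifs with h
    · linarith [hanti j h]
    · exact le_rfl
  · contrapose!
    intro h
    simp [not_lt.2 h]
  · induction i with
    | zero =>
      intro _
      rw [hinge, Finset.sum_eq_zero, affineLine_apply]
      · ring
      · intro j _
        rw [max_eq_left, mul_zero]
        exact sub_nonpos.2 (hs.monotone (Nat.zero_le _))
    | succ i ih =>
      intro hi
      have hinc : hinge s N (fun j => if j < N then σ j - σ (j + 1) else 0) (s (i + 1)) -
          hinge s N (fun j => if j < N then σ j - σ (j + 1) else 0) (s i) =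
          (σ 0 - σ i) * (s (i + 1) - s i) := by
        have htel : σ 0 - σ i = ∑ j ∈ Finset.range i, (σ j - σ (j + 1)) := by
          rw [Finset.sum_range_sub']
        rw [htel, hinge, hinge, ← Finset.sum_sub_distrib, Finset.sum_mul]
        rw [← Finset.sum_subset (Finset.range_subset_range.2 (show i ≤ N by omega))]
        · refine Finset.sum_congr rfl fun j hj => ?_
          rw [Finset.mem_range] at hj
          have h1 : s (j + 1) ≤ s i := hs.monotone (by omega)
          have h2 := hd i
          rw [if_pos (by omega), max_eq_right (by linarith), max_eq_right (by linarith)]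
          ring
        · intro j _ hj
          rw [Finset.mem_range] at hj
          have h1 : s (i + 1) ≤ s (j + 1) := hs.monotone (by omega)
          have h2 := hd i
          rw [max_eq_left (by linarith), max_eq_left (by linarith)]
          ring
      have hstep : X (i + 1) - X i = σ i * (s (i + 1) - s i) :=
        (div_mul_cancel₀ _ (hd i).ne').symm
      have := ih (by omega)
      rw [affineLine_apply] at this ⊢
      linarith

/-! ### Subdivisions are determined by their breaks -/

variable {ι : Type*} {r : ι → ℝ}

lemma regularSubdivision_affine_add (g : ℝ →ᵃ[ℝ] ℝ) (y : ι → ℝ) :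
    regularSubdivision r (fun i => g (r i) + y i) = regularSubdivision r y := by
  ext F
  constructor
  · rintro ⟨f, h1, rfl⟩
    refine ⟨f - g, fun i => ?_, Set.ext fun i => ?_⟩
    · have := h1 i
      simp only [AffineMap.coe_sub, Pi.sub_apply]
      linarith
    · simp only [AffineMap.coe_sub, Pi.sub_apply, Set.mem_ofPred_eq]
      constructor <;> intro h <;> linarith
  · rintro ⟨f, h1, rfl⟩
    refine ⟨g + f, fun i => ?_, Set.ext fun i => ?_⟩
    · have := h1 i
      simp only [AffineMap.coe_add, Pi.add_apply]
      linarith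
    · simp only [AffineMap.coe_add, Pi.add_apply, Set.mem_ofPred_eq]
      constructor <;> intro h <;> linarith

/-- The subdivision induced by `-hinge s N w`. -/
noncomputable def hingeSubdivision (r : ι → ℝ) (s : ℕ → ℝ) (N : ℕ) (w : ℕ → ℝ) : Set (Set ι) :=
  regularSubdivision r (fun i => -hinge s N w (r i))

variable (hs : StrictMono s) (hrs : Set.range r = s '' Set.Iic (N + 1))
  (hw : ∀ j, 0 ≤ w j) (hwN : ∀ j, w j ≠ 0 → j < N)
  (hw' : ∀ j, 0 ≤ w' j) (hwN' : ∀ j, w' j ≠ 0 → j < N)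

-- A nonempty cell of `w` has no break of `w` strictly between two of its values, hence none of
-- `w'`. The linear piece of `w'` starting at the first value of the cell therefore touches at the
-- whole cell.
include hs hrs hw hw' hwN in
lemma hingeSubdivision_refines (h : ∀ j, w' j ≠ 0 → w j ≠ 0) :
    Refines (hingeSubdivision r s N w) (hingeSubdivision r s N w') := by
  classical
  have hidx : ∀ i, ∃ m ≤ N + 1, s m = r i := fun i => by
    have : r i ∈ s '' Set.Iic (N + 1) := hrs ▸ Set.mem_range_self i
    exact this
  have hpt : ∀ m ≤ N + 1, ∃ i, r i = s m := fun m hm => by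
    have : s m ∈ Set.range r := hrs ▸ Set.mem_image_of_mem s hm
    exact this
  rintro F ⟨f, hf, rfl⟩
  by_cases hne : ∃ m, m ≤ N + 1 ∧ -hinge s N w (s m) = f (s m)
  · obtain ⟨ha, hfa⟩ := Nat.find_spec hne
    have hmin := fun m => Nat.find_min' hne (m := m)
    set a := Nat.find hne
    refine ⟨_, ⟨hingePiece s N w' a, fun i => neg_hinge_le_hingePiece hw' _ _, rfl⟩, ?_⟩
    intro i hi
    obtain ⟨m, hm, hmi⟩ := hidx i
    change -hinge s N w (r i) = f (r i) at hi
    change -hinge s N w' (r i) = _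
    rw [← hmi] at hi ⊢
    have ham := hmin m ⟨hm, hi⟩
    refine neg_hinge_eq_hingePiece fun j hj => ⟨fun hja => hs.monotone (show j + 1 ≤ m by omega),
      fun hja => ?_⟩
    by_contra hlt
    push Not at hlt
    have hjN := hwN j (h j hj)
    obtain ⟨i', hi'⟩ := hpt (j + 1) (by omega)
    exact not_touch_both_sides hw hjN (h j hj) (hs (by omega)) hlt (hi' ▸ hf i') hfa hi
  -- The cell is empty here, so any cell of `w'` contains it.
  · refine ⟨_, ⟨hingePiece s N w' 0, fun i => neg_hinge_le_hingePiece hw' _ _, rfl⟩, ?_⟩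
    intro i hi
    obtain ⟨m, hm, hmi⟩ := hidx i
    refine absurd ⟨m, hm, ?_⟩ hne
    rw [hmi]
    exact hi

-- If `j` were not a break of `w`, one cell of `w` would contain `s j`, `s (j + 1)` and `s (j + 2)`;
-- no cell of `w'` does, since `s (j + 1)` is a break of `w'`.
include hs hrs hw hw' hwN' in
lemma support_of_hingeSubdivision_refines
    (h : Refines (hingeSubdivision r s N w) (hingeSubdivision r s N w')) {j : ℕ}
    (hj : w' j ≠ 0) : w j ≠ 0 := by
  intro hwj
  have hjN := hwN' j hj
  have hpt : ∀ m ≤ N + 1, ∃ i, r i = s m := fun m hm => by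
    have : s m ∈ Set.range r := hrs ▸ Set.mem_image_of_mem s hm
    exact this
  obtain ⟨G, ⟨g, hg, rfl⟩, hG⟩ := h _ ⟨hingePiece s N w j,
    fun i => neg_hinge_le_hingePiece hw _ _, rfl⟩
  have touch : ∀ m, j ≤ m → m ≤ j + 2 → -hinge s N w' (s m) = g (s m) := by
    intro m h1 h2
    obtain ⟨i, hi⟩ := hpt m (by omega)
    have : i ∈ {i | -hinge s N w' (r i) = g (r i)} := by
      refine hG ?_
      change -hinge s N w (r i) = hingePiece s N w j (r i)
      rw [hi]
      refine neg_hinge_eq_hingePiece (m := j) fun l hl => ⟨fun hlj => hs.monotone (show l + 1 ≤ m by omega),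
        fun hlj => ?_⟩
      have hne : l ≠ j := by
        rintro rfl
        exact hl hwj
      exact hs.monotone (show m ≤ l + 1 by omega)
    change -hinge s N w' (r i) = g (r i) at this
    rwa [hi] at this
  exact not_touch_both_sides hw' hjN hj (hs (Nat.lt_succ_self j)) (hs (Nat.lt_succ_self (j + 1)))
    (touch (j + 1) (by omega) (by omega)).le (touch j le_rfl (by omega))
    (touch (j + 2) (by omega) le_rfl)

-- For small `ε > 0`, `z = w' - ε • w` is nonnegative with breaks among those of `w`, so a cell `F`
-- of `w` lies in a cell of `z`. Adding `ε` times the affine function of `F` to that of the larger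
-- cell cuts out exactly `F` for `w'`: equality in the sum forces equality in both terms.
include hs hrs hw hw' hwN in
lemma hingeSubdivision_subset (h : ∀ j, w j ≠ 0 ↔ w' j ≠ 0) :
    hingeSubdivision r s N w ⊆ hingeSubdivision r s N w' := by
  obtain ⟨ε, hε, hεw⟩ : ∃ ε > 0, ∀ j, ε * w j ≤ w' j := by
    have hev : ∀ᶠ ε in nhdsWithin (0 : ℝ) (Set.Ioi 0), ∀ j ∈ Finset.range N, ε * w j ≤ w' j := by
      rw [Filter.eventually_all_finset]
      intro j _
      by_cases hj : w j = 0
      · have : w' j = 0 := by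
          by_contra h'
          exact (h j).2 h' hj
        simp [hj, this]
      · have hpos : 0 < w' j := lt_of_le_of_ne (hw' j) (Ne.symm ((h j).1 hj))
        have ht : Filter.Tendsto (fun ε : ℝ => ε * w j) (nhdsWithin 0 (Set.Ioi 0)) (nhds 0) := by
          have : Filter.Tendsto (fun ε : ℝ => ε * w j) (nhds 0) (nhds (0 * w j)) :=
            (continuous_id.mul continuous_const).tendsto 0
          rw [zero_mul] at this
          exact this.mono_left nhdsWithin_le_nhds
        exact (ht.eventually (gt_mem_nhds hpos)).mono fun _ => le_of_lt
    obtain ⟨ε, h1, h2⟩ := (hev.and self_mem_nhdsWithin).exists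
    refine ⟨ε, h2, fun j => ?_⟩
    by_cases hj : j < N
    · exact h1 j (Finset.mem_range.2 hj)
    · have e1 : w j = 0 := by
        by_contra h'
        exact hj (hwN j h')
      rw [e1, mul_zero]
      exact hw' j
  set z : ℕ → ℝ := fun j => w' j - ε * w j with hz
  have hsum : ∀ u, -hinge s N w' u = ε * -hinge s N w u + -hinge s N z u := by
    intro u
    simp only [hinge, hz, sub_mul, Finset.sum_sub_distrib, mul_assoc, ← Finset.mul_sum]
    ring
  rintro F ⟨f, hf, rfl⟩
  obtain ⟨G, ⟨g, hg, rfl⟩, hFG⟩ := hingeSubdivision_refines (w' := z) hs hrs hw hwN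
    (fun j => sub_nonneg.2 (hεw j)) (fun j hj hwj => hj (by
      have : w' j = 0 := by
        by_contra h'
        exact (h j).2 h' hwj
      simp [hz, hwj, this])) _ ⟨f, hf, rfl⟩
  refine ⟨ε • f + g, fun i => ?_, Set.ext fun i => ?_⟩
  · simp only [AffineMap.coe_add, AffineMap.coe_smul, Pi.add_apply, Pi.smul_apply, smul_eq_mul]
    rw [hsum]
    exact add_le_add (mul_le_mul_of_nonneg_left (hf i) hε.le) (hg i)
  · simp only [AffineMap.coe_add, AffineMap.coe_smul, Pi.add_apply, Pi.smul_apply, smul_eq_mul,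
      Set.mem_ofPred_eq]
    rw [hsum]
    constructor
    · intro hi
      have h2 : -hinge s N z (r i) = g (r i) := hFG hi
      rw [hi, h2]
    · intro hi
      have h1 := mul_le_mul_of_nonneg_left (hf i) hε.le
      have h2 := hg i
      have h3 : ε * -hinge s N w (r i) = ε * f (r i) := by linarith
      exact mul_left_cancel₀ hε.ne' h3

include hs hrs hw hw' hwN hwN' in
lemma hingeSubdivision_congr (h : ∀ j, w j ≠ 0 ↔ w' j ≠ 0) :
    hingeSubdivision r s N w = hingeSubdivision r s N w' :=
  (hingeSubdivision_subset hs hrs hw hwN hw' h).antisymm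
    (hingeSubdivision_subset hs hrs hw' hwN' hw fun j => (h j).symm)

/-! ### Secant points and coverings by pairs -/

include hs hw in
/-- If `k + 1` affine functions above `-hinge s N w` touch it at all of `s m, …, s (N + 1)`, then
the breaks beyond `s m` are covered by `k` pairs. -/
lemma exists_pairs_of_touching {κ : Type*} [DecidableEq κ] (f : κ → ℝ →ᵃ[ℝ] ℝ)
    (hf : ∀ j, ∀ i ≤ N + 1, -hinge s N w (s i) ≤ f j (s i)) (k : ℕ) :
    ∀ (J : Finset κ) (m : ℕ), J.card = k + 1 → m ≤ N + 1 →
      (∀ i, m ≤ i → i ≤ N + 1 → ∃ j ∈ J, -hinge s N w (s i) = f j (s i)) →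
      ∃ g : Fin k → ℕ, ∀ b, m ≤ b → b < N → w b ≠ 0 → ∃ j, b = g j ∨ b = g j + 1 := by
  classical
  have hstep : ∀ (J : Finset κ) (m : ℕ), m ≤ N + 1 →
      (∀ i, m ≤ i → i ≤ N + 1 → ∃ j ∈ J, -hinge s N w (s i) = f j (s i)) →
      ∃ j ∈ J, ∃ e, m ≤ e ∧ e ≤ N + 1 ∧ (∀ i, e < i → i ≤ N + 1 → -hinge s N w (s i) ≠ f j (s i)) ∧
        ∀ b, m ≤ b → b < N → w b ≠ 0 → e ≤ b + 1 := by
    intro J m hm hJ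
    obtain ⟨j, hj, hmj⟩ := hJ m le_rfl hm
    -- The last value touched by a function that touches at `s m`; a break strictly between the two
    -- is impossible.
    set e := Nat.findGreatest (fun i => -hinge s N w (s i) = f j (s i)) (N + 1)
    have he : -hinge s N w (s e) = f j (s e) :=
      Nat.findGreatest_spec (P := fun i => -hinge s N w (s i) = f j (s i)) hm hmj
    refine ⟨j, hj, e, Nat.le_findGreatest hm hmj, Nat.findGreatest_le _,
      fun i hi hiN => Nat.findGreatest_is_greatest hi hiN, fun b hb hbN hwb => ?_⟩
    by_contra hlt
    push Not at hlt
    exact not_touch_both_sides hw hbN hwb (hs (Nat.lt_succ_of_le hb)) (hs hlt)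
      (hf j _ (by omega)) hmj he
  induction k with
  | zero =>
    intro J m hJ hm hcov
    refine ⟨Fin.elim0, fun b hb hbN hwb => ?_⟩
    -- The single function must also touch at `s (b + 2)`, which lies beyond its last touching value
    -- `s e`.
    obtain ⟨j, hj, e, he, heN, hgt, hbr⟩ := hstep J m hm hcov
    have heb := hbr b hb hbN hwb
    obtain ⟨j', hj', ht⟩ := hcov (b + 2) (by omega) (by omega)
    obtain ⟨a, ha⟩ := Finset.card_eq_one.1 hJ
    rw [ha, Finset.mem_singleton] at hj hj'
    subst hj hj'
    exact absurd ht (hgt _ (by omega) (by omega))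
  | succ k ih =>
    intro J m hJ hm hcov
    obtain ⟨j, hj, e, he, heN, hgt, hbr⟩ := hstep J m hm hcov
    by_cases heN' : e = N + 1
    · refine ⟨fun _ => 0, fun b hb hbN hwb => ?_⟩
      have := hbr b hb hbN hwb
      omega
    · obtain ⟨g, hg⟩ := ih (J.erase j) (e + 1) (by rw [Finset.card_erase_of_mem hj, hJ]; rfl)
        (by omega) (fun i hi hiN => by
          obtain ⟨j', hj', ht⟩ := hcov i (by omega) hiN
          refine ⟨j', Finset.mem_erase.2 ⟨?_, hj'⟩, ht⟩
          rintro rfl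
          exact hgt i (by omega) hiN ht)
      -- The values `s e` and `s (e + 1)` carry the break labels `e - 1` and `e`. For `e = 0` the
      -- truncated pair is `{0, 1}`, which still contains the only possible label `0`.
      refine ⟨Fin.cons (e - 1) g, fun b hb hbN hwb => ?_⟩
      have heb := hbr b hb hbN hwb
      by_cases hbe : e + 1 ≤ b
      · obtain ⟨l, hl⟩ := hg b hbe hbN hwb
        exact ⟨l.succ, by simpa using hl⟩
      · refine ⟨0, ?_⟩
        rw [Fin.cons_zero]
        omega

/-- The indicator weights of a set of breaks. -/
noncomputable def breakWeight (B : Set ℕ) : ℕ → ℝ := B.indicator 1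

lemma breakWeight_nonneg (B : Set ℕ) (j : ℕ) : 0 ≤ breakWeight B j :=
  Set.indicator_nonneg (fun _ _ => zero_le_one) j

@[simp] lemma breakWeight_ne_zero {B : Set ℕ} {j : ℕ} : breakWeight B j ≠ 0 ↔ j ∈ B := by
  simp [breakWeight]

include hs hrs in
/-- The faces of the secant complex correspond to the sets of breaks that are covered
by `k` pairs. -/
theorem secantComplex_eq_image (k : ℕ) :
    secantComplex r k =
      (fun B => hingeSubdivision r s N (breakWeight B)) '' {B | B ⊆ Set.Iio N ∧ PairCover k B} := by
  classical
  have hidx : ∀ i, ∃ m ≤ N + 1, s m = r i := fun i => by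
    have : r i ∈ s '' Set.Iic (N + 1) := hrs ▸ Set.mem_range_self i
    exact this
  have hpt : ∀ m, ∃ i, m ≤ N + 1 → r i = s m := fun m => by
    by_cases hm : m ≤ N + 1
    · have : s m ∈ Set.range r := hrs ▸ Set.mem_image_of_mem s hm
      obtain ⟨i, hi⟩ := this
      exact ⟨i, fun _ => hi⟩
    · have : s 0 ∈ Set.range r := hrs ▸ Set.mem_image_of_mem s (Nat.zero_le _)
      obtain ⟨i, hi⟩ := this
      exact ⟨i, fun h => absurd h hm⟩
  ext S
  constructor
  · rintro ⟨x, hx, rfl⟩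
    obtain ⟨f, h1, h2⟩ := (mk_mem_secantVariety_iff r x k).1 hx
    choose p hp using hpt
    -- Labels at the same point have the same height, so `x` is a function of the values of `r`.
    have hfac : ∀ i i', r i = r i' → x i ≤ x i' := by
      intro i i' h
      obtain ⟨j, hj⟩ := h2 i'
      rw [hj, ← h]
      exact h1 j i
    obtain ⟨h, w, hw, hwN, hX⟩ := exists_eq_sub_hinge (N := N) hs (fun m => x (p m)) (by
      intro m hm
      obtain ⟨j, hj⟩ := h2 (p m)
      refine ⟨f j, by rw [hj, hp m hm], fun i hi => ?_⟩
      rw [← hp i hi]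
      exact h1 j (p i))
    have hx' : x = fun i => h (r i) + -hinge s N w (r i) := by
      funext i
      obtain ⟨m, hm, hmi⟩ := hidx i
      have e : r (p m) = r i := by rw [hp m hm, hmi]
      rw [(hfac i (p m) e.symm).antisymm (hfac (p m) i e), hX m hm, hmi, sub_eq_add_neg]
    refine ⟨Function.support w, ⟨fun j hj => hwN j hj, ?_⟩, ?_⟩
    · obtain ⟨g, hg⟩ := exists_pairs_of_touching (N := N) hs hw (fun j => f j - h)
        (by
          intro j i hi
          have := h1 j (p i)
          rw [hx'] at this
          simp only [hp i hi] at this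
          simp only [AffineMap.coe_sub, Pi.sub_apply]
          linarith) k Finset.univ 0 (by simp) (Nat.zero_le _) (by
          intro i _ hi
          obtain ⟨j, hj⟩ := h2 (p i)
          refine ⟨j, Finset.mem_univ j, ?_⟩
          rw [hx'] at hj
          simp only [hp i hi] at hj
          simp only [AffineMap.coe_sub, Pi.sub_apply]
          linarith)
      exact ⟨g, fun b hb => hg b (Nat.zero_le b) (hwN b hb) hb⟩
    · rw [hx', regularSubdivision_affine_add]
      exact hingeSubdivision_congr hs hrs (breakWeight_nonneg _)
        (fun j hj => hwN j (breakWeight_ne_zero.1 hj)) hw hwN fun j => breakWeight_ne_zero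
  · rintro ⟨B, ⟨hBN, g, hg⟩, rfl⟩
    -- The leftmost piece, and for each pair the piece to the right of both its breaks. The piece
    -- between the two breaks of a pair is not needed: it contains only the values at these breaks,
    -- and the neighbouring pieces touch there.
    refine ⟨_, (mk_mem_secantVariety_iff r _ k).2 ⟨fun j => hingePiece s N (breakWeight B)
      (Fin.cons (α := fun _ => ℕ) 0 (fun j => g j + 2) j), fun j i =>
        neg_hinge_le_hingePiece (breakWeight_nonneg B) _ _, fun i => ?_⟩, rfl⟩
    obtain ⟨m, hm, hmi⟩ := hidx i
    by_cases hne : ∃ b, b ∈ B ∧ b + 1 < m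
    · obtain ⟨l, ⟨hlB, hlm⟩, hmax⟩ : ∃ l, (l ∈ B ∧ l + 1 < m) ∧ ∀ b ∈ B, b + 1 < m → b ≤ l := by
        obtain ⟨b, hb, hbm⟩ := hne
        refine ⟨Nat.findGreatest (fun b => b ∈ B ∧ b + 1 < m) m,
          Nat.findGreatest_spec (P := fun b => b ∈ B ∧ b + 1 < m) (m := b) (by omega) ⟨hb, hbm⟩,
          fun c hc hcm => Nat.le_findGreatest (by omega) ⟨hc, hcm⟩⟩
      obtain ⟨j, hj⟩ := hg l hlB
      refine ⟨j.succ, ?_⟩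
      beta_reduce
      rw [Fin.cons_succ, ← hmi]
      refine neg_hinge_eq_hingePiece fun b hb => ⟨fun h =>
        hs.monotone (show b + 1 ≤ m by omega), fun h => ?_⟩
      refine hs.monotone ?_
      by_contra hlt
      have := hmax b (breakWeight_ne_zero.1 hb) (by omega)
      omega
    · refine ⟨0, ?_⟩
      beta_reduce
      rw [Fin.cons_zero, ← hmi]
      refine neg_hinge_eq_hingePiece fun b hb => ⟨fun h => absurd h (Nat.not_lt_zero b), fun _ => ?_⟩
      refine hs.monotone ?_
      by_contra hlt
      exact hne ⟨b, breakWeight_ne_zero.1 hb, by omega⟩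

include hs hrs in
theorem hingeSubdivision_breakWeight_refines_iff {B B' : Set ℕ} (hB : B ⊆ Set.Iio N)
    (hB' : B' ⊆ Set.Iio N) :
    Refines (hingeSubdivision r s N (breakWeight B')) (hingeSubdivision r s N (breakWeight B)) ↔
      B ⊆ B' := by
  constructor
  · intro h j hj
    exact breakWeight_ne_zero.1 (support_of_hingeSubdivision_refines hs hrs (breakWeight_nonneg _)
      (breakWeight_nonneg _) (fun j hj => hB (breakWeight_ne_zero.1 hj)) h
      (breakWeight_ne_zero.2 hj))
  · intro h
    exact hingeSubdivision_refines hs hrs (breakWeight_nonneg _)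
      (fun j hj => hB' (breakWeight_ne_zero.1 hj)) (breakWeight_nonneg _)
      (fun j hj => breakWeight_ne_zero.2 (h (breakWeight_ne_zero.1 hj)))

end Hinge


/-! ### Lower faces of cyclic polytopes via polynomials -/

section LowerFaces

open Polynomial

/-- The face of a convex hull on which a linear functional is minimal is spanned by generators. -/
lemma minimizers_convexHull {D : ℕ} (V : Set (Fin D → ℝ)) (c : Fin D → ℝ) :
    {p | p ∈ convexHull ℝ V ∧ ∀ q ∈ convexHull ℝ V, c ⬝ᵥ p ≤ c ⬝ᵥ q} =
      convexHull ℝ {v | v ∈ V ∧ ∀ v' ∈ V, c ⬝ᵥ v ≤ c ⬝ᵥ v'} := by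
  have hlin : ∀ a : ℝ, Convex ℝ {q | a ≤ c ⬝ᵥ q} := fun a =>
    convex_halfSpace_ge ⟨dotProduct_add c, fun r x => dotProduct_smul r c x⟩ a
  have hlin' : ∀ a : ℝ, Convex ℝ {q | c ⬝ᵥ q ≤ a} := fun a =>
    convex_halfSpace_le ⟨dotProduct_add c, fun r x => dotProduct_smul r c x⟩ a
  apply Set.Subset.antisymm
  · rintro p ⟨hp, hmin⟩
    obtain ⟨κ, _, w, a, hw0, hw1, ha, rfl⟩ := mem_convexHull_iff_exists_fintype.1 hp
    set m := c ⬝ᵥ ∑ i, w i • a i with hm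
    have hge : ∀ i, m ≤ c ⬝ᵥ a i := fun i => hmin _ (subset_convexHull ℝ V (ha i))
    have hsum : ∑ i, w i * (c ⬝ᵥ a i - m) = 0 := by
      simp only [mul_sub, Finset.sum_sub_distrib, ← Finset.sum_mul, hw1, one_mul]
      rw [hm, dotProduct_sum]
      simp [dotProduct_smul]
    -- The nonnegative excesses average to zero, so every generator with nonzero weight is itself a
    -- minimizer.
    have hzero := (Finset.sum_eq_zero_iff_of_nonneg fun i _ =>
      mul_nonneg (hw0 i) (sub_nonneg.2 (hge i))).1 hsum
    classical
    rw [← Finset.sum_subset (Finset.subset_univ {i | w i ≠ 0})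
      (fun i _ hi => by
        have : w i = 0 := by simpa using hi
        rw [this, zero_smul])]
    refine (convex_convexHull ℝ _).sum_mem (fun i _ => hw0 i)
      (by rwa [Finset.sum_filter_ne_zero]) fun i hi => subset_convexHull ℝ _ ⟨ha i, fun v hv => ?_⟩
    have h1 : w i ≠ 0 := by simpa using hi
    have h2 := (mul_eq_zero.1 (hzero i (Finset.mem_univ i))).resolve_left h1
    have h3 := hmin v (subset_convexHull ℝ V hv)
    linarith
  · intro p hp
    refine ⟨convexHull_mono (fun v hv => hv.1) hp, fun q hq => ?_⟩
    refine convexHull_min (fun v hv => ?_) (hlin _) hq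
    exact convexHull_min (fun v' hv' => hv'.2 v hv) (hlin' _) hp

lemma dotProduct_momentCurve {D : ℕ} (p : ℝ[X]) (hp : p.natDegree ≤ D) (u : ℝ) :
    (fun i : Fin D => p.coeff (i + 1)) ⬝ᵥ momentCurve D u = p.eval u - p.coeff 0 := by
  rw [eval_eq_sum_range' (Nat.lt_succ_of_le hp), Finset.sum_range_succ', pow_zero, mul_one,
    add_sub_cancel_right, Finset.sum_range]
  rfl

/-- A polynomial of odd degree with positive leading coefficient has a root to the left of every
point at which it is nonnegative. -/
lemma exists_root_le_of_odd {q : ℝ[X]} (hodd : Odd q.natDegree) (hlead : 0 < q.leadingCoeff)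
    {u : ℝ} (hu : 0 ≤ q.eval u) : ∃ v ≤ u, q.eval v = 0 := by
  have hX : (-X : ℝ[X]).natDegree = 1 := by rw [natDegree_neg, natDegree_X]
  have hlim : Filter.Tendsto (fun x => (q.comp (-X)).eval x) Filter.atTop Filter.atBot := by
    refine tendsto_atBot_of_leadingCoeff_nonpos _ ?_ ?_
    · rw [← natDegree_pos_iff_degree_pos, natDegree_comp, hX, mul_one]
      exact hodd.pos
    · rw [leadingCoeff_comp (by rw [hX]; exact one_ne_zero), leadingCoeff_neg, leadingCoeff_X,
        hodd.neg_one_pow]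
      linarith
  obtain ⟨x, hx, hxu⟩ := ((hlim.eventually_le_atBot 0).and (Filter.eventually_ge_atTop (-u))).exists
  rw [eval_comp, eval_neg, eval_X] at hx
  obtain ⟨v, hv, hv0⟩ := intermediate_value_Icc (show -x ≤ u by linarith)
    q.continuous.continuousOn ⟨hx, hu⟩
  exact ⟨v, hv.2, hv0⟩

lemma exists_eq_X_sub_C_mul {p : ℝ[X]} {a : ℝ} {n : ℕ} (ha : p.eval a = 0)
    (hdeg : p.natDegree = n + 1) (hlead : 0 < p.leadingCoeff) :
    ∃ q : ℝ[X], p = (X - C a) * q ∧ q.natDegree = n ∧ 0 < q.leadingCoeff := by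
  obtain ⟨q, rfl⟩ := dvd_iff_isRoot.2 ha
  have hq : q ≠ 0 := by
    rintro rfl
    simp at hlead
  refine ⟨q, rfl, ?_, ?_⟩
  · rw [natDegree_mul (X_sub_C_ne_zero a) hq, natDegree_X_sub_C] at hdeg
    omega
  · rwa [leadingCoeff_mul, leadingCoeff_X_sub_C, one_mul] at hlead

variable {t : ℕ → ℝ} (ht : StrictMono t)

include ht in
/-- The zeros among `t m, …, t (N - 1)` of a polynomial of degree `2 * k` with positive leading
coefficient that is nonnegative on these points are covered by `k` pairs. -/
lemma exists_pairs_of_eval_nonneg (N k : ℕ) :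
    ∀ (p : ℝ[X]) (m : ℕ), p.natDegree = 2 * k → 0 < p.leadingCoeff →
      (∀ j, m ≤ j → j < N → 0 ≤ p.eval (t j)) →
      ∃ g : Fin k → ℕ, ∀ b, m ≤ b → b < N → p.eval (t b) = 0 → ∃ j, b = g j ∨ b = g j + 1 := by
  classical
  induction k with
  | zero =>
    intro p m hdeg hlead _
    refine ⟨Fin.elim0, fun b _ _ hb => ?_⟩
    rw [eq_C_of_natDegree_eq_zero hdeg] at hb hlead
    rw [eval_C] at hb
    rw [leadingCoeff_C] at hlead
    exact absurd hb hlead.ne'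
  | succ k ih =>
    intro p m hdeg hlead hp
    by_cases hne : ∃ b, m ≤ b ∧ b < N ∧ p.eval (t b) = 0
    · obtain ⟨b, ⟨hmb, hbN, hb⟩, hmin⟩ : ∃ b, (m ≤ b ∧ b < N ∧ p.eval (t b) = 0) ∧
          ∀ c, (m ≤ c ∧ c < N ∧ p.eval (t c) = 0) → b ≤ c :=
        ⟨Nat.find hne, Nat.find_spec hne, fun c => Nat.find_min' hne⟩
      by_cases hb1 : b + 1 < N
      · obtain ⟨q, rfl, hqdeg, hqlead⟩ := exists_eq_X_sub_C_mul (n := 2 * k + 1) hb hdeg hlead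
        have hlt := ht (Nat.lt_succ_self b)
        have hq : 0 ≤ q.eval (t (b + 1)) := by
          have := hp (b + 1) (by omega) hb1
          rw [eval_mul, eval_sub, eval_X, eval_C] at this
          exact nonneg_of_mul_nonneg_right this (sub_pos.2 hlt)
        -- Parity yields a second root at or before `t (b + 1)`, not necessarily one of the `t j`.
        -- Dividing out both roots lowers the degree by two and keeps the signs from label `b + 2`
        -- on.
        obtain ⟨v, hv, hv0⟩ := exists_root_le_of_odd (hqdeg ▸ odd_two_mul_add_one k) hqlead hq
        obtain ⟨h, rfl, hhdeg, hhlead⟩ := exists_eq_X_sub_C_mul hv0 hqdeg hqlead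
        have hfac : ∀ j, b + 2 ≤ j → 0 < t j - t b ∧ 0 < t j - v := fun j hj =>
          ⟨sub_pos.2 (ht (by omega)), sub_pos.2 (hv.trans_lt (ht (by omega)))⟩
        obtain ⟨g, hg⟩ := ih h (b + 2) hhdeg hhlead (fun j hj hjN => by
          have := hp j (by omega) hjN
          simp only [eval_mul, eval_sub, eval_X, eval_C] at this
          exact nonneg_of_mul_nonneg_right (nonneg_of_mul_nonneg_right this (hfac j hj).1)
            (hfac j hj).2)
        refine ⟨Fin.cons b g, fun c hc hcN hc0 => ?_⟩
        have hbc := hmin c ⟨hc, hcN, hc0⟩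
        by_cases hcb : b + 2 ≤ c
        · simp only [eval_mul, eval_sub, eval_X, eval_C] at hc0
          obtain ⟨l, hl⟩ := hg c hcb hcN (((mul_eq_zero.1 ((mul_eq_zero.1 hc0).resolve_left
            (hfac c hcb).1.ne')).resolve_left (hfac c hcb).2.ne'))
          exact ⟨l.succ, by simpa using hl⟩
        · refine ⟨0, ?_⟩
          rw [Fin.cons_zero]
          omega
      · refine ⟨fun _ => b, fun c hc hcN hc0 => ⟨0, ?_⟩⟩
        have hbc := hmin c ⟨hc, hcN, hc0⟩
        change c = b ∨ c = b + 1
        omega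
    · exact ⟨fun _ => 0, fun b h1 h2 h3 => absurd ⟨b, h1, h2, h3⟩ hne⟩

-- No `t i` lies strictly between `t n` and `t (n + 1)`, so the product of the two linear factors is
-- nonnegative at every `t i`. If only one of the labels is in `B` its factor is squared, and if
-- neither is, `X ^ 2 + 1` keeps the degree at two.
include ht in
lemma exists_quadratic (B : Set ℕ) (n : ℕ) :
    ∃ q : ℝ[X], q.Monic ∧ q.natDegree = 2 ∧
      ∀ i, 0 ≤ q.eval (t i) ∧ (q.eval (t i) = 0 ↔ i ∈ B ∧ (i = n ∨ i = n + 1)) := by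
  have hmonic : ∀ a b : ℝ, ((X - C a) * (X - C b)).Monic ∧ ((X - C a) * (X - C b)).natDegree = 2 :=
    fun a b => ⟨(monic_X_sub_C a).mul (monic_X_sub_C b), by
      rw [(monic_X_sub_C a).natDegree_mul (monic_X_sub_C b), natDegree_X_sub_C, natDegree_X_sub_C]⟩
  have heval : ∀ (a b : ℕ) i, ((X - C (t a)) * (X - C (t b))).eval (t i) =
      (t i - t a) * (t i - t b) := fun a b i => by simp
  have hzero : ∀ a b i, (t i - t a) * (t i - t b) = 0 ↔ i = a ∨ i = b := fun a b i => by
    rw [mul_eq_zero, sub_eq_zero, sub_eq_zero, ht.injective.eq_iff, ht.injective.eq_iff]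
  by_cases h0 : n ∈ B <;> by_cases h1 : n + 1 ∈ B
  · refine ⟨(X - C (t n)) * (X - C (t (n + 1))), (hmonic _ _).1, (hmonic _ _).2, fun i => ?_⟩
    rw [heval]
    refine ⟨?_, ?_⟩
    · rcases Nat.lt_or_ge n i with hi | hi
      · exact mul_nonneg (sub_nonneg.2 (ht.monotone hi.le)) (sub_nonneg.2 (ht.monotone hi))
      · exact mul_nonneg_of_nonpos_of_nonpos (sub_nonpos.2 (ht.monotone hi))
          (sub_nonpos.2 (ht.monotone (hi.trans n.le_succ)))
    · rw [hzero]
      constructor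
      · rintro (rfl | rfl) <;> simp [h0, h1]
      · exact fun h => h.2
  · refine ⟨(X - C (t n)) * (X - C (t n)), (hmonic _ _).1, (hmonic _ _).2, fun i => ?_⟩
    rw [heval, hzero]
    refine ⟨mul_self_nonneg _, ?_⟩
    constructor
    · rintro (rfl | rfl) <;> simp [h0]
    · rintro ⟨hi, rfl | rfl⟩
      · simp
      · exact absurd hi h1
  · refine ⟨(X - C (t (n + 1))) * (X - C (t (n + 1))), (hmonic _ _).1, (hmonic _ _).2, fun i => ?_⟩
    rw [heval, hzero]
    refine ⟨mul_self_nonneg _, ?_⟩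
    constructor
    · rintro (rfl | rfl) <;> simp [h1]
    · rintro ⟨hi, rfl | rfl⟩
      · exact absurd hi h0
      · simp
  · refine ⟨X ^ 2 + C 1, monic_X_pow_add_C 1 two_ne_zero, natDegree_X_pow_add_C, fun i => ?_⟩
    have hpos : 0 < (X ^ 2 + C (1 : ℝ)).eval (t i) := by
      simp only [eval_add, eval_pow, eval_X, eval_C]
      positivity
    refine ⟨hpos.le, fun h => absurd h hpos.ne', ?_⟩
    rintro ⟨hi, rfl | rfl⟩
    · exact absurd hi h0
    · exact absurd hi h1

include ht in
lemma exists_polynomial_of_pairCover {k : ℕ} {B : Set ℕ} (hB : PairCover k B) :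
    ∃ p : ℝ[X], p.Monic ∧ p.natDegree = 2 * k ∧
      ∀ i, 0 ≤ p.eval (t i) ∧ (p.eval (t i) = 0 ↔ i ∈ B) := by
  obtain ⟨g, hg⟩ := hB
  choose q hq1 hq2 hq3 using fun n => exists_quadratic ht B n
  refine ⟨∏ j, q (g j), monic_prod_of_monic _ _ fun j _ => hq1 _, ?_, fun i => ?_⟩
  · rw [natDegree_prod_of_monic _ _ fun j _ => hq1 _]
    simp [hq2, mul_comm]
  · rw [eval_prod]
    refine ⟨Finset.prod_nonneg fun j _ => (hq3 _ i).1, ?_⟩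
    rw [Finset.prod_eq_zero_iff]
    constructor
    · rintro ⟨j, -, hj⟩
      exact ((hq3 _ i).2.1 hj).1
    · intro hi
      obtain ⟨j, hj⟩ := hg i hi
      exact ⟨j, Finset.mem_univ j, (hq3 _ i).2.2 ⟨hi, hj⟩⟩

/-- The convex hull of the points of the moment curve with labels in `B`. -/
def momentHull (D : ℕ) (t : ℕ → ℝ) (B : Set ℕ) : Set (Fin D → ℝ) :=
  convexHull ℝ ((fun j => momentCurve D (t j)) '' B)

lemma momentHull_mono {D : ℕ} {B B' : Set ℕ} (h : B ⊆ B') : momentHull D t B ⊆ momentHull D t B' :=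
  convexHull_mono (Set.image_mono h)

/-- The minimizers over a cyclic polytope, by labels. -/
lemma minimizers_momentHull {D : ℕ} (A : Set ℕ) (c : Fin D → ℝ) :
    {p | p ∈ momentHull D t A ∧ ∀ q ∈ momentHull D t A, c ⬝ᵥ p ≤ c ⬝ᵥ q} =
      momentHull D t {j | j ∈ A ∧
        ∀ l ∈ A, c ⬝ᵥ momentCurve D (t j) ≤ c ⬝ᵥ momentCurve D (t l)} := by
  rw [momentHull, momentHull, minimizers_convexHull]
  congr 1
  ext v
  constructor
  · rintro ⟨⟨j, hj, rfl⟩, h⟩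
    exact ⟨j, ⟨hj, fun l hl => h _ ⟨l, hl, rfl⟩⟩, rfl⟩
  · rintro ⟨j, ⟨hj, h⟩, rfl⟩
    refine ⟨⟨j, hj, rfl⟩, ?_⟩
    rintro _ ⟨l, hl, rfl⟩
    exact h l hl

include ht in
/-- The lower faces of a cyclic polytope correspond to the sets of labels that are covered by
`k` pairs. -/
theorem lowerFaces_momentHull (N k : ℕ) :
    lowerFaces (momentHull (2 * k) t (Set.Iio N)) =
      momentHull (2 * k) t '' {B | B ⊆ Set.Iio N ∧ PairCover k B} := by
  have hempty : (∅ : Set ℕ) ∈ {B | B ⊆ Set.Iio N ∧ PairCover k B} :=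
    ⟨Set.empty_subset _, fun _ => 0, fun b hb => absurd hb (Set.notMem_empty b)⟩
  ext F
  constructor
  · rintro (rfl | ⟨c, ⟨i, hi, hci⟩, rfl⟩)
    · exact ⟨∅, hempty, by simp [momentHull]⟩
    · rw [minimizers_momentHull]
      refine ⟨_, ⟨fun j hj => hj.1, ?_⟩, rfl⟩
      set M := {j | j ∈ Set.Iio N ∧ ∀ l ∈ Set.Iio N,
        c ⬝ᵥ momentCurve (2 * k) (t j) ≤ c ⬝ᵥ momentCurve (2 * k) (t l)} with hM
      rcases M.eq_empty_or_nonempty with h0 | ⟨a, ha⟩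
      · rw [h0]
        exact hempty.2
      -- The functional along the moment curve minus its minimum over the labels, so that the
      -- minimizing labels are zeros.
      set p : ℝ[X] := ∑ l : Fin (2 * k), C (c l) * X ^ (l.val + 1) -
        C (c ⬝ᵥ momentCurve (2 * k) (t a)) with hp
      have heval : ∀ u, p.eval u =
          c ⬝ᵥ momentCurve (2 * k) u - c ⬝ᵥ momentCurve (2 * k) (t a) := by
        intro u
        rw [hp, eval_sub, eval_C, eval_finsetSum]
        congr 1
        simp [dotProduct, momentCurve]
      have hdeg : p.natDegree ≤ 2 * k := by
        refine (natDegree_sub_le _ _).trans (max_le ?_ (by simp))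
        refine natDegree_sum_le_of_forall_le _ _ fun l _ => (natDegree_C_mul_X_pow_le _ _).trans ?_
        exact l.2
      have hcoeff : p.coeff (2 * k) = c i := by
        rw [hp, coeff_sub, coeff_C_of_ne_zero (by omega), sub_zero, finsetSum_coeff,
          Finset.sum_eq_single i]
        · rw [coeff_C_mul_X_pow, if_pos hi.symm]
        · intro l _ hl
          rw [coeff_C_mul_X_pow, if_neg]
          intro h
          exact hl (Fin.ext (by omega))
        · exact fun h => absurd (Finset.mem_univ i) h
      have hdeg' : p.natDegree = 2 * k :=
        natDegree_eq_of_le_of_coeff_ne_zero hdeg (by rw [hcoeff]; exact hci.ne')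
      obtain ⟨g, hg⟩ := exists_pairs_of_eval_nonneg ht N k p 0 hdeg'
        (by rw [leadingCoeff, hdeg', hcoeff]; exact hci)
        (fun j _ hj => by rw [heval]; exact sub_nonneg.2 (ha.2 j hj))
      refine ⟨g, fun b hb => hg b (Nat.zero_le b) hb.1 ?_⟩
      rw [heval]
      exact sub_eq_zero.2 ((hb.2 a ha.1).antisymm (ha.2 b hb.1))
  · rintro ⟨B, ⟨hBN, hB⟩, rfl⟩
    rcases B.eq_empty_or_nonempty with rfl | ⟨a, ha⟩
    · exact Or.inl (by simp [momentHull])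
    · obtain ⟨p, hmon, hdeg, hp⟩ := exists_polynomial_of_pairCover ht hB
      -- A nonempty `B` needs a pair; hence the last coordinate exists, and the monic polynomial
      -- gives it coefficient `1`.
      have hk : 0 < k := by
        obtain ⟨g, hg⟩ := hB
        obtain ⟨j, -⟩ := hg a ha
        exact j.pos
      refine Or.inr ⟨fun i => p.coeff (i + 1), ⟨⟨2 * k - 1, by omega⟩, ?_, ?_⟩, ?_⟩
      · simp only
        omega
      · have : 2 * k - 1 + 1 = p.natDegree := by omega
        simp only [this, coeff_natDegree, hmon.leadingCoeff]
        exact one_pos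
      · rw [minimizers_momentHull]
        congr 1
        ext j
        simp only [dotProduct_momentCurve p hdeg.le, sub_le_sub_iff_right]
        have ha0 := (hp a).2.2 ha
        constructor
        · intro hj
          refine ⟨hBN hj, fun l _ => ?_⟩
          rw [(hp j).2.2 hj]
          exact (hp l).1
        · rintro ⟨-, hj⟩
          refine (hp j).2.1 (le_antisymm ?_ (hp j).1)
          rw [← ha0]
          exact hj a (hBN ha)

-- The polynomial with zero set `B'` defines a half-space containing the hull of `B'`; a point of
-- the curve with label outside `B'` is strictly outside it.
include ht in
theorem momentHull_subset_iff {k : ℕ} {B B' : Set ℕ} (hB' : PairCover k B') :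
    momentHull (2 * k) t B ⊆ momentHull (2 * k) t B' ↔ B ⊆ B' := by
  refine ⟨fun h b hb => ?_, momentHull_mono⟩
  obtain ⟨p, -, hdeg, hp⟩ := exists_polynomial_of_pairCover ht hB'
  set c : Fin (2 * k) → ℝ := fun i => p.coeff (i + 1)
  have hconv : Convex ℝ {q | c ⬝ᵥ q ≤ -p.coeff 0} :=
    convex_halfSpace_le ⟨dotProduct_add c, fun r x => dotProduct_smul r c x⟩ _
  have hmem : momentCurve (2 * k) (t b) ∈ {q | c ⬝ᵥ q ≤ -p.coeff 0} := by
    refine convexHull_min ?_ hconv (h (subset_convexHull ℝ _ ⟨b, hb, rfl⟩))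
    rintro _ ⟨j, hj, rfl⟩
    change c ⬝ᵥ momentCurve (2 * k) (t j) ≤ _
    rw [dotProduct_momentCurve p hdeg.le, (hp j).2.2 hj, zero_sub]
  change c ⬝ᵥ momentCurve (2 * k) (t b) ≤ _ at hmem
  rw [dotProduct_momentCurve p hdeg.le] at hmem
  exact (hp b).2.1 (le_antisymm (by linarith) (hp b).1)

end LowerFaces


/-! ### Matching the two complexes -/

lemma exists_equiv_of_eq_image {α β γ : Type*} {A : Set α} {A' : Set β} {C : Set γ} {G : γ → α}
    {H : γ → β} (hA : A = G '' C) (hA' : A' = H '' C) (hG : Set.InjOn G C) (hH : Set.InjOn H C) :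
    ∃ φ : A ≃ A', ∀ S : A, ∃ B ∈ C, (S : α) = G B ∧ (φ S : β) = H B := by
  subst hA hA'
  refine ⟨(Equiv.Set.imageOfInjOn G C hG).symm.trans (Equiv.Set.imageOfInjOn H C hH), fun S => ?_⟩
  refine ⟨_, ((Equiv.Set.imageOfInjOn G C hG).symm S).2, ?_, rfl⟩
  exact congrArg Subtype.val ((Equiv.Set.imageOfInjOn G C hG).apply_symm_apply S).symm

lemma Refines.refl {ι : Type*} (S : Set (Set ι)) : Refines S S := fun F hF => ⟨F, hF, subset_rfl⟩

/-- The values of a nonconstant vector in increasing order. -/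
lemma exists_strictMono_enumeration {ι : Type*} [Finite ι] (r : ι → ℝ) (hr : ∃ i j, r i ≠ r j) :
    ∃ s : ℕ → ℝ, StrictMono s ∧
      Set.range r = s '' Set.Iic ((Set.range r).ncard - 2 + 1) := by
  have hfin : (Set.range r).Finite := Set.finite_range r
  have hcard : hfin.toFinset.card = (Set.range r).ncard :=
    (Set.ncard_eq_toFinset_card _ hfin).symm
  -- With at least two values the natural subtraction does not truncate, and `ncard - 2 + 1` is the
  -- last index.
  have h2 : 1 < (Set.range r).ncard := by
    obtain ⟨i, j, hij⟩ := hr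
    exact (Set.one_lt_ncard hfin).2 ⟨_, ⟨i, rfl⟩, _, ⟨j, rfl⟩, hij⟩
  obtain ⟨s, hs, hsu⟩ := exists_strictMono_extension _
    (hfin.toFinset.orderEmbOfFin hcard).strictMono
  refine ⟨s, hs, Set.ext fun x => ?_⟩
  have hx : x ∈ Set.range r ↔ x ∈ Set.range (hfin.toFinset.orderEmbOfFin hcard) := by
    rw [Finset.range_orderEmbOfFin, Set.Finite.coe_toFinset]
  rw [hx]
  constructor
  · rintro ⟨i, rfl⟩
    refine ⟨i, ?_, hsu i⟩
    have := i.2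
    rw [Set.mem_Iic]
    omega
  · rintro ⟨i, hi, rfl⟩
    rw [Set.mem_Iic] at hi
    exact ⟨⟨i, by omega⟩, (hsu ⟨i, by omega⟩).symm⟩

lemma cyclicPolytope_eq_momentHull {D N : ℕ} {t : Fin N → ℝ} {t' : ℕ → ℝ}
    (h : ∀ j : Fin N, t' j = t j) : cyclicPolytope D t = momentHull D t' (Set.Iio N) := by
  rw [cyclicPolytope, momentHull]
  congr 1
  ext v
  constructor
  · rintro ⟨j, rfl⟩
    exact ⟨j, j.2, by simp only [h]⟩
  · rintro ⟨j, hj, rfl⟩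
    exact ⟨⟨j, hj⟩, by simp only [← h]⟩

end TropicalSecant

open TropicalSecant in
theorem theorem3p1 (n k : ℕ) (r : Fin (n + 1) → ℝ) (hr : ∃ i j, r i ≠ r j)
    (t : Fin ((Set.range r).ncard - 2) → ℝ) (ht : StrictMono t) :
    ∃ φ : TropicalSecant.secantComplex r k ≃
        TropicalSecant.lowerFaces (TropicalSecant.cyclicPolytope (2 * k) t),
      ∀ S T : TropicalSecant.secantComplex r k,
        TropicalSecant.Refines (T : Set (Set (Fin (n + 1)))) (S : Set (Set (Fin (n + 1)))) ↔
          (φ S : Set (Fin (2 * k) → ℝ)) ⊆ (φ T : Set (Fin (2 * k) → ℝ)) := by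
  obtain ⟨s, hs, hrs⟩ := exists_strictMono_enumeration r hr
  obtain ⟨t', ht', htt⟩ := exists_strictMono_extension t ht
  have hlow := lowerFaces_momentHull ht' ((Set.range r).ncard - 2) k
  rw [← cyclicPolytope_eq_momentHull htt] at hlow
  -- Both parametrizations by break sets reflect the order, hence are injective.
  obtain ⟨φ, hφ⟩ := exists_equiv_of_eq_image (secantComplex_eq_image hs hrs k) hlow
    (by
      intro B hB B' hB' h
      have h1 := hingeSubdivision_breakWeight_refines_iff hs hrs hB.1 hB'.1
      have h2 := hingeSubdivision_breakWeight_refines_iff hs hrs hB'.1 hB.1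
      beta_reduce at h
      rw [h] at h1 h2
      exact (h1.1 (Refines.refl _)).antisymm (h2.1 (Refines.refl _)))
    (by
      intro B hB B' hB' h
      exact ((momentHull_subset_iff ht' hB'.2).1 h.subset).antisymm
        ((momentHull_subset_iff ht' hB.2).1 h.symm.subset))
  refine ⟨φ, fun S T => ?_⟩
  obtain ⟨B, hB, hS, hφS⟩ := hφ S
  obtain ⟨B', hB', hT, hφT⟩ := hφ T
  rw [hS, hT, hφS, hφT, hingeSubdivision_breakWeight_refines_iff hs hrs hB.1 hB'.1,
    momentHull_subset_iff ht' hB'.2]
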